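/- Let $d\in\mathbb N$, let $\bar\Omega$ be a (symmetric positive definite) $d\times d$ correlation matrix, $\alpha\in\mathbb R^d$ and $\tau\in\mathbb R$. Let $\Phi$ be the standard normal distribution function and $\phi_d(\cdot\,;\bar\Omega)$ the density of the normal distribution $N_d(0,\bar\Omega)$. Let $X=(X_1,\dots,X_d)\sim ESN_d(\bar\Omega,\alpha,\tau)$ be a standardised extended skew-normal random vector, i.e. a random vector in $\mathbb R^d$ with Lebesgue density $$x\mapsto \frac{\phi_d(x;\bar\Omega)}{\Phi\bigl(\tau/\sqrt{1+\alpha^\top\bar\Omega\alpha}\bigr)}\,\Phi(\alpha^\top x+\tau).$$ Let $F_i$ denote the distribution function of $X_i$. Then the following hold. (1) For all $1\le i<j\le d$, the upper-tail dependence coefficient of $(X_i,X_j)$ exists and is zero: $$\chi=\lim_{u\to0^+}\frac{\Pr\bigl(F_i(X_i)\ge 1-u,\;F_j(X_j)\ge 1-u\bigr)}{u}=0 .$$ (2) The suitably normalised componentwise maxima have independent standard Gumbel limits: there are $a_n\in(0,\infty)^d$ and $b_n\in\mathbb R^d$, $n\ge1$, such that whenever $S_1,S_2,\dots$ are independent copies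 of $X$ and $M_{n,j}=\max_{1\le m\le n}S_{m,j}$, $$\lim_{n\to\infty}\Pr\Bigl(\frac{M_{n,j}-b_{n,j}}{a_{n,j}}\le x_j\ \text{ for all } 1\le j\le d\Bigr)=\prod_{j=1}^d e^{-e^{-x_j}}\qquad\text{for all }x\in\mathbb R^d .$$ -/

import Mathlib

open MeasureTheory ProbabilityTheory Filter Topology
open scoped Matrix

noncomputable section

namespace ExtSkewNormal

/-- A nonsingular correlation matrix: symmetric positive definite with unit diagonal. -/
structure IsCorrelation {d : ℕ} (R : Matrix (Fin d) (Fin d) ℝ) : Prop where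
  posDef : R.PosDef
  diag_one : ∀ i, R i i = 1

/-- The standard univariate normal cumulative distribution function `Φ`. -/
def stdNormalCDF (x : ℝ) : ℝ := cdf (gaussianReal 0 1) x

/-- The density of the centred `d`-variate normal distribution with covariance matrix `R`. -/
def normalPDF {d : ℕ} (R : Matrix (Fin d) (Fin d) ℝ) (x : Fin d → ℝ) : ℝ :=
  (Real.sqrt ((2 * Real.pi) ^ d * R.det))⁻¹ * Real.exp (-(x ⬝ᵥ (R⁻¹ *ᵥ x)) / 2)

/-- The density of the standardised extended skew-normal distribution with correlation matrix `R`,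
slant parameter `α` and extension parameter `τ`. -/
def esnPDF {d : ℕ} (R : Matrix (Fin d) (Fin d) ℝ) (α : Fin d → ℝ) (τ : ℝ) (x : Fin d → ℝ) : ℝ :=
  normalPDF R x / stdNormalCDF (τ / Real.sqrt (1 + α ⬝ᵥ (R *ᵥ α))) * stdNormalCDF (α ⬝ᵥ x + τ)

/-- The standardised extended skew-normal distribution on `ℝ^d`. -/
def esn {d : ℕ} (R : Matrix (Fin d) (Fin d) ℝ) (α : Fin d → ℝ) (τ : ℝ) : Measure (Fin d → ℝ) :=
  volume.withDensity (fun x => ENNReal.ofReal (esnPDF R α τ x))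

/-- The upper-tail dependence function
`χ(u) = P(F_Y(Y) ≥ 1 - u, F_Z(Z) ≥ 1 - u) / u` of two real random variables `Y`, `Z`, where
`F_Y`, `F_Z` are their distribution functions. -/
def tailDependence {Ω : Type*} [MeasurableSpace Ω] (P : Measure Ω) (Y Z : Ω → ℝ) (u : ℝ) : ℝ :=
  P.real {ω | 1 - u ≤ cdf (P.map Y) (Y ω) ∧ 1 - u ≤ cdf (P.map Z) (Z ω)} / u

/-- The `j`-th componentwise maximum of the first `n` vectors of a sample (used for `n ≥ 1`). -/
def sampleMax {Ω : Type*} {d : ℕ} (S : ℕ → Ω → Fin d → ℝ) (n : ℕ) (j : Fin d) (ω : Ω) : ℝ :=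
  ⨆ m : Fin n, S m ω j

end ExtSkewNormal

end

/-! The density is a Gaussian density weighted by Φ(αᵀx + τ), and Φ(αᵀx + τ) is the probability that
an independent standard normal E satisfies E ≤ αᵀx + τ. Everything is therefore governed by a
quadratic form in (θ, c), `jointForm`, the variance of θᵀx + c(αᵀx - E).

Margins: splitting αᵀx into a multiple of x_i and an independent Gaussian residual and integrating
the residual out gives the density C φ(z) Φ(β_i z + γ_i) for the i-th coordinate (`esn_map_eval`).
For β_i < 0 the factor Φ also decays like a Gaussian, so the tail G_i(t) behaves like exp(-κ_i t²/2)
with κ_i = 1 + min(β_i, 0)². L'Hôpital's rule gives G_i(t + x/(κ_i t)) / G_i(t) → exp(-x)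
(`tendsto_skewTail_ratio`), the Gumbel domain of attraction.

Dependence: a Chernoff bound with Φ(y) ≤ exp(cy + c²/2), c ≥ 0, controls linear functionals. The
least value of the form at e_i over c ≥ 0 is 1/κ_i, so the rescaled vectors √κ_i e_i have form 1. By
the parallelogram law their sum has form 4 - q with q > 0, since they are distinct and the form is
positive. Hence with r = √κ_i s + √κ_j t the joint exceedance is at most exp(-(1/8 + q/32) r² +
O(r)), while the larger marginal tail is at least exp(-r²/8 - O(r)): see `exists_joint_exp_bound`
and `joint_exceedance_negligible`.

Applied at the levels where both tails equal u, this gives χ = 0. For maxima, Bonferroni's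
inequalities make n times the probability of some exceedance converge to the sum of the marginal
limits, and (1 - p_n)^n turns the sum into a product. -/

noncomputable section

namespace ExtSkewNormal

/-! ### Calculus of the standard normal law and of tail integrals -/

/-- The standard normal density. -/
abbrev stdNormalPDF (x : ℝ) : ℝ := gaussianPDFReal 0 1 x

lemma continuous_stdNormalPDF : Continuous stdNormalPDF := by
  unfold stdNormalPDF gaussianPDFReal
  fun_prop

lemma stdNormalPDF_pos (x : ℝ) : 0 < stdNormalPDF x := gaussianPDFReal_pos _ _ _ one_ne_zero

lemma integrable_stdNormalPDF : Integrable stdNormalPDF := integrable_gaussianPDFReal 0 1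

lemma stdNormalPDF_eq (x : ℝ) :
    stdNormalPDF x = (Real.sqrt (2 * Real.pi))⁻¹ * Real.exp (-x ^ 2 / 2) := by
  simp [stdNormalPDF, gaussianPDFReal]

lemma stdNormalPDF_neg (x : ℝ) : stdNormalPDF (-x) = stdNormalPDF x := by
  simp [stdNormalPDF_eq]

lemma ofReal_stdNormalCDF (x : ℝ) :
    ENNReal.ofReal (stdNormalCDF x) = gaussianReal 0 1 (Set.Iic x) := ofReal_cdf _ x

lemma stdNormalCDF_eq_integral (x : ℝ) :
    stdNormalCDF x = ∫ z in Set.Iic x, stdNormalPDF z := by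
  rw [stdNormalCDF, cdf_eq_real, measureReal_def, gaussianReal_apply_eq_integral _ one_ne_zero,
    ENNReal.toReal_ofReal]
  exact integral_nonneg fun z => (stdNormalPDF_pos z).le

lemma hasDerivAt_integral_Iic {f : ℝ → ℝ} (hf : Continuous f) (hi : Integrable f) (x : ℝ) :
    HasDerivAt (fun t => ∫ z in Set.Iic t, f z) (f x) x := by
  have h : (fun t => ∫ z in Set.Iic t, f z)
      = fun t => (∫ z in Set.Iic (0 : ℝ), f z) + ∫ z in (0 : ℝ)..t, f z := by
    ext t
    rw [← intervalIntegral.integral_Iic_sub_Iic hi.integrableOn hi.integrableOn]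
    ring
  rw [h]
  exact (intervalIntegral.integral_hasDerivAt_right (hf.intervalIntegrable _ _)
    hf.aestronglyMeasurable.stronglyMeasurableAtFilter hf.continuousAt).const_add _

lemma hasDerivAt_integral_Ioi {f : ℝ → ℝ} (hf : Continuous f) (hi : Integrable f) (x : ℝ) :
    HasDerivAt (fun t => ∫ z in Set.Ioi t, f z) (-f x) x := by
  have h : (fun t => ∫ z in Set.Ioi t, f z) = fun t => (∫ z, f z) - ∫ z in Set.Iic t, f z := by
    ext t
    rw [← intervalIntegral.integral_Iic_add_Ioi (b := t) hi.integrableOn hi.integrableOn]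
    ring
  rw [h]
  exact (hasDerivAt_integral_Iic hf hi x).const_sub _

lemma tendsto_integral_Ioi_atTop {f : ℝ → ℝ} (hi : Integrable f) :
    Tendsto (fun t => ∫ z in Set.Ioi t, f z) atTop (𝓝 0) := by
  have h := intervalIntegral_tendsto_integral_Ioi (μ := volume) 0 hi.integrableOn tendsto_id
  have h2 := (tendsto_const_nhds (x := ∫ z in Set.Ioi (0 : ℝ), f z)).sub h
  rw [sub_self] at h2
  refine h2.congr fun t => ?_
  rw [← intervalIntegral.integral_Ioi_sub_Ioi' hi.integrableOn hi.integrableOn]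
  simp

lemma hasDerivAt_stdNormalCDF (x : ℝ) : HasDerivAt stdNormalCDF (stdNormalPDF x) x := by
  have h := hasDerivAt_integral_Iic continuous_stdNormalPDF integrable_stdNormalPDF x
  rwa [← funext stdNormalCDF_eq_integral] at h

lemma continuous_stdNormalCDF : Continuous stdNormalCDF :=
  continuous_iff_continuousAt.2 fun x => (hasDerivAt_stdNormalCDF x).continuousAt

lemma stdNormalCDF_nonneg (x : ℝ) : 0 ≤ stdNormalCDF x := cdf_nonneg _ x

lemma stdNormalCDF_le_one (x : ℝ) : stdNormalCDF x ≤ 1 := cdf_le_one _ x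

lemma monotone_stdNormalCDF : Monotone stdNormalCDF := monotone_cdf _

lemma strictMono_stdNormalCDF : StrictMono stdNormalCDF :=
  strictMono_of_hasDerivAt_pos hasDerivAt_stdNormalCDF stdNormalPDF_pos

lemma stdNormalCDF_pos (x : ℝ) : 0 < stdNormalCDF x :=
  (stdNormalCDF_nonneg (x - 1)).trans_lt (strictMono_stdNormalCDF (by linarith))

/-- Integrate only over the unit interval just left of -y. The loss affects only the lower-order
terms of the exponent, which is all the later comparison needs. -/
lemma stdNormalPDF_le_stdNormalCDF {y : ℝ} (hy : 0 ≤ y) :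
    stdNormalPDF (y + 1) ≤ stdNormalCDF (-y) := by
  have hi : IntegrableOn stdNormalPDF (Set.Ioc (-y - 1) (-y)) :=
    integrable_stdNormalPDF.integrableOn
  calc stdNormalPDF (y + 1) = ∫ _ in Set.Ioc (-y - 1) (-y), stdNormalPDF (y + 1) := by
        simp
    _ ≤ ∫ z in Set.Ioc (-y - 1) (-y), stdNormalPDF z := by
        refine setIntegral_mono_on (by simp) hi measurableSet_Ioc fun z hz => ?_
        rw [stdNormalPDF_eq, stdNormalPDF_eq]
        refine mul_le_mul_of_nonneg_left (Real.exp_le_exp.2 ?_) (by positivity)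
        nlinarith [hz.1, hz.2]
    _ ≤ stdNormalCDF (-y) := by
        rw [stdNormalCDF_eq_integral]
        refine setIntegral_mono_set integrable_stdNormalPDF.integrableOn
          (Eventually.of_forall fun z => (stdNormalPDF_pos z).le) ?_
        exact (Set.Ioc_subset_Iic_self).eventuallyLE

/-! ### Tail ratios at von Mises shifts -/

/-- A von Mises type condition: if the density ratio at `t + x / (κ t)` converges, so does the
tail ratio. -/
lemma tendsto_tail_ratio {f G : ℝ → ℝ} {κ x L : ℝ} (hf : ∀ t, 0 < f t)
    (hG : ∀ t, HasDerivAt G (-f t) t) (h0 : Tendsto G atTop (𝓝 0))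
    (hr : Tendsto (fun t => f (t + x / (κ * t)) / f t) atTop (𝓝 L)) :
    Tendsto (fun t => G (t + x / (κ * t)) / G t) atTop (𝓝 L) := by
  have hinv : Tendsto (fun t : ℝ => x / (κ * t)) atTop (𝓝 0) := by
    have h := (tendsto_inv_atTop_zero (𝕜 := ℝ)).const_mul (x / κ)
    rw [mul_zero] at h
    refine h.congr fun t => ?_
    rw [div_mul_eq_div_div, div_eq_mul_inv _ t]
  have hshift : Tendsto (fun t : ℝ => t + x / (κ * t)) atTop atTop :=
    tendsto_id.atTop_add hinv
  -- L'Hôpital: the shift has derivative 1 - (x/κ)/t² → 1, so the quotient of derivatives has the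
  -- limit of the density ratio.
  refine HasDerivAt.lhopital_zero_atTop
    (f' := fun t => -f (t + x / (κ * t)) * (1 - (x / κ) / t ^ 2)) (g' := fun t => -f t)
    ?_ (Eventually.of_forall hG) (Eventually.of_forall fun t => (neg_neg_of_pos (hf t)).ne)
    (h0.comp hshift) h0 ?_
  · filter_upwards [eventually_gt_atTop 0] with t ht
    have hd : HasDerivAt (fun t : ℝ => t + x / (κ * t)) (1 - (x / κ) / t ^ 2) t := by
      have h := (hasDerivAt_id t).add ((hasDerivAt_inv ht.ne').const_mul (x / κ))
      refine (h.congr_deriv ?_).congr_of_eventuallyEq (Eventually.of_forall fun s => ?_)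
      · field_simp
        ring
      · simp only [Pi.add_apply, id_eq, div_eq_mul_inv, mul_inv, mul_assoc]
    exact (hG (t + x / (κ * t))).comp t hd
  · have h2 : Tendsto (fun t : ℝ => 1 - (x / κ) / t ^ 2) atTop (𝓝 1) := by
      have h := (tendsto_const_nhds (x := x / κ)).div_atTop
        (tendsto_pow_atTop (α := ℝ) two_ne_zero)
      simpa using h.const_sub 1
    have h3 := hr.mul h2
    rw [mul_one] at h3
    refine h3.congr fun t => ?_
    have := (hf t).ne'
    field_simp

lemma tendsto_stdNormalPDF_ratio {κ : ℝ} (hκ : 0 < κ) (x : ℝ) :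
    Tendsto (fun t => stdNormalPDF (t + x / (κ * t)) / stdNormalPDF t) atTop
      (𝓝 (Real.exp (-(x / κ)))) := by
  have h1 : Tendsto (fun t : ℝ => -(x / κ) - (x / κ) ^ 2 / 2 / t ^ 2) atTop (𝓝 (-(x / κ))) := by
    have h := (tendsto_const_nhds (x := (x / κ) ^ 2 / 2)).div_atTop
      (tendsto_pow_atTop (α := ℝ) two_ne_zero)
    simpa using h.const_sub (-(x / κ))
  refine ((Real.continuous_exp.tendsto _).comp h1).congr' ?_
  filter_upwards [eventually_gt_atTop 0] with t ht
  rw [stdNormalPDF_eq, stdNormalPDF_eq, mul_div_mul_left _ _ (by positivity), ← Real.exp_sub]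
  simp only [Function.comp_apply]
  congr 1
  field_simp
  ring

lemma tendsto_stdNormalCDF_neg_atTop : Tendsto (fun y => stdNormalCDF (-y)) atTop (𝓝 0) :=
  (tendsto_cdf_atBot (gaussianReal 0 1)).comp tendsto_neg_atTop_atBot

lemma tendsto_stdNormalCDF_atTop : Tendsto stdNormalCDF atTop (𝓝 1) :=
  tendsto_cdf_atTop (gaussianReal 0 1)

lemma tendsto_stdNormalCDF_neg_ratio (x : ℝ) :
    Tendsto (fun y => stdNormalCDF (-(y + x / y)) / stdNormalCDF (-y)) atTop
      (𝓝 (Real.exp (-x))) := by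
  have h := tendsto_tail_ratio (f := stdNormalPDF) (G := fun y => stdNormalCDF (-y)) (κ := 1)
    (x := x) (L := Real.exp (-x)) stdNormalPDF_pos (fun t => ?_) tendsto_stdNormalCDF_neg_atTop
    (by simpa using tendsto_stdNormalPDF_ratio one_pos x)
  · simpa using h
  · have h := (hasDerivAt_stdNormalCDF (-t)).comp t (hasDerivAt_neg t)
    rw [stdNormalPDF_neg] at h
    simpa using! h

/-- Monotonicity of Φ traps the varying shift between constant shifts x' on either side of x. -/
lemma tendsto_stdNormalCDF_neg_ratio_of_tendsto {ξ : ℝ → ℝ} {x : ℝ}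
    (hξ : Tendsto ξ atTop (𝓝 x)) :
    Tendsto (fun y => stdNormalCDF (-(y + ξ y / y)) / stdNormalCDF (-y)) atTop
      (𝓝 (Real.exp (-x))) := by
  have hc : Continuous fun x : ℝ => Real.exp (-x) := by fun_prop
  refine tendsto_order.2 ⟨fun a ha => ?_, fun a ha => ?_⟩
  · obtain ⟨x', hx', hax'⟩ : ∃ x' > x, a < Real.exp (-x') := by
      have := (hc.tendsto x).eventually (lt_mem_nhds ha)
      have h2 : ∀ᶠ x' in 𝓝[>] x, a < Real.exp (-x') := this.filter_mono nhdsWithin_le_nhds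
      obtain ⟨x', h3, h4⟩ := (h2.and self_mem_nhdsWithin).exists
      exact ⟨x', h4, h3⟩
    filter_upwards [(tendsto_stdNormalCDF_neg_ratio x').eventually (lt_mem_nhds hax'),
      hξ.eventually (gt_mem_nhds hx'), eventually_gt_atTop 0] with y h1 h2 h3
    refine h1.trans_le ?_
    have := stdNormalCDF_pos (-y)
    gcongr
    apply monotone_stdNormalCDF
    gcongr
  · obtain ⟨x', hx', hax'⟩ : ∃ x' < x, Real.exp (-x') < a := by
      have := (hc.tendsto x).eventually (gt_mem_nhds ha)
      have h2 : ∀ᶠ x' in 𝓝[<] x, Real.exp (-x') < a := this.filter_mono nhdsWithin_le_nhds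
      obtain ⟨x', h3, h4⟩ := (h2.and self_mem_nhdsWithin).exists
      exact ⟨x', h4, h3⟩
    filter_upwards [(tendsto_stdNormalCDF_neg_ratio x').eventually (gt_mem_nhds hax'),
      hξ.eventually (lt_mem_nhds hx'), eventually_gt_atTop 0] with y h1 h2 h3
    refine lt_of_le_of_lt ?_ h1
    have := stdNormalCDF_pos (-y)
    gcongr
    apply monotone_stdNormalCDF
    gcongr

/-- Only β < 0 contributes decay. There y = -βt - γ → ∞, and the shift takes the form ξ(y)/y with
ξ(y) → β²x/κ. For β = 0 the ratio is constant, and for β > 0 both values of Φ tend to 1. -/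
lemma tendsto_stdNormalCDF_affine_ratio (β γ x : ℝ) {κ : ℝ} (hκ : 0 < κ) :
    Tendsto (fun t => stdNormalCDF (β * (t + x / (κ * t)) + γ) / stdNormalCDF (β * t + γ)) atTop
      (𝓝 (Real.exp (-((min β 0) ^ 2 * x / κ)))) := by
  rcases lt_trichotomy β 0 with hβ | rfl | hβ
  · have hy : Tendsto (fun t : ℝ => -β * t - γ) atTop atTop :=
      tendsto_atTop_add_const_right _ (-γ) (tendsto_id.const_mul_atTop (neg_pos.2 hβ))
    have hξ : Tendsto (fun y : ℝ => y * (β ^ 2 * x) / (κ * (y + γ))) atTop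
        (𝓝 (β ^ 2 * x / κ)) := by
      have h1 : Tendsto (fun y : ℝ => 1 - γ / (y + γ)) atTop (𝓝 1) := by
        have h := (tendsto_const_nhds (x := γ)).div_atTop
          (tendsto_atTop_add_const_right _ γ tendsto_id)
        simpa using! h.const_sub 1
      have h2 := h1.mul_const (β ^ 2 * x / κ)
      rw [one_mul] at h2
      refine h2.congr' ?_
      filter_upwards [eventually_gt_atTop (-γ)] with y hy
      have : y + γ ≠ 0 := by linarith
      field_simp
      ring
    rw [min_eq_left hβ.le]
    refine ((tendsto_stdNormalCDF_neg_ratio_of_tendsto hξ).comp hy).congr' ?_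
    filter_upwards [eventually_gt_atTop 0, hy.eventually_gt_atTop 0] with t ht hyt
    simp only [Function.comp_apply]
    have h2 : -β * t - γ + γ = -β * t := by ring
    have h3 : β ≠ 0 := hβ.ne
    have h4 : ∀ y : ℝ, y ≠ 0 → y * (β ^ 2 * x) / (κ * (-β * t)) / y = -(β * (x / (κ * t))) := by
      intro y hy
      field_simp
    rw [h2, h4 _ hyt.ne']
    congr 2 <;> ring
  · have := (stdNormalCDF_pos γ).ne'
    simp [this]
  · have hinv : Tendsto (fun t : ℝ => x / (κ * t)) atTop (𝓝 0) :=
      tendsto_const_nhds.div_atTop (tendsto_id.const_mul_atTop hκ)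
    have h1 : Tendsto (fun t : ℝ => β * t + γ) atTop atTop :=
      tendsto_atTop_add_const_right _ γ (tendsto_id.const_mul_atTop hβ)
    have h2 := h1.comp (tendsto_id.atTop_add hinv)
    have h3 := (tendsto_stdNormalCDF_atTop.comp h2).div (tendsto_stdNormalCDF_atTop.comp h1)
      one_ne_zero
    simpa [min_eq_right hβ.le] using! h3

/-! ### The univariate extended skew-normal tail -/

/-- The unnormalised univariate extended skew-normal density. -/
def skewPDF (C β γ z : ℝ) : ℝ := C * (stdNormalPDF z * stdNormalCDF (β * z + γ))

/-- The tail integral of `skewPDF`. -/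
def skewTail (C β γ t : ℝ) : ℝ := ∫ z in Set.Ioi t, skewPDF C β γ z

/-- The exponential rate of decay of `skewTail`. -/
def tailRate (β : ℝ) : ℝ := 1 + (min β 0) ^ 2

lemma tailRate_pos (β : ℝ) : 0 < tailRate β := by unfold tailRate; positivity

section skew

variable {C β γ : ℝ}

lemma continuous_skewPDF : Continuous (skewPDF C β γ) := by
  have := continuous_stdNormalPDF
  have := continuous_stdNormalCDF
  unfold skewPDF
  fun_prop

lemma skewPDF_pos (hC : 0 < C) (z : ℝ) : 0 < skewPDF C β γ z :=
  mul_pos hC (mul_pos (stdNormalPDF_pos z) (stdNormalCDF_pos _))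

lemma integrable_skewPDF : Integrable (skewPDF C β γ) := by
  refine Integrable.const_mul ?_ C
  have hc := continuous_stdNormalCDF
  refine integrable_stdNormalPDF.mul_of_top_left
    (memLp_top_of_bound (C := 1) ?_ (Eventually.of_forall fun z => ?_))
  · exact Continuous.aestronglyMeasurable (by fun_prop)
  · rw [Real.norm_of_nonneg (stdNormalCDF_nonneg _)]
    exact stdNormalCDF_le_one _

lemma hasDerivAt_skewTail (t : ℝ) : HasDerivAt (skewTail C β γ) (-skewPDF C β γ t) t :=
  hasDerivAt_integral_Ioi continuous_skewPDF integrable_skewPDF t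

lemma tendsto_skewTail_atTop : Tendsto (skewTail C β γ) atTop (𝓝 0) :=
  tendsto_integral_Ioi_atTop integrable_skewPDF

/-- The Gaussian factor contributes the rate x/κ and Φ contributes min(β, 0)² x/κ; `tailRate` is the
κ for which they add up to x. -/
lemma tendsto_skewTail_ratio (hC : 0 < C) (x : ℝ) :
    Tendsto (fun t => skewTail C β γ (t + x / (tailRate β * t)) / skewTail C β γ t) atTop
      (𝓝 (Real.exp (-x))) := by
  refine tendsto_tail_ratio (skewPDF_pos hC) hasDerivAt_skewTail tendsto_skewTail_atTop ?_
  have h := (tendsto_stdNormalPDF_ratio (tailRate_pos β) x).mul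
    (tendsto_stdNormalCDF_affine_ratio β γ x (tailRate_pos β))
  rw [← Real.exp_add] at h
  have he : -(x / tailRate β) + -((min β 0) ^ 2 * x / tailRate β) = -x := by
    have := (tailRate_pos β).ne'
    field_simp
    rw [tailRate]
    ring
  rw [he] at h
  refine h.congr fun t => ?_
  simp only [skewPDF]
  rw [mul_div_mul_left _ _ hC.ne', mul_div_mul_comm]

lemma exists_exp_le_skewTail (hC : 0 < C) :
    ∃ A B : ℝ, ∀ s, 0 ≤ s →
      Real.exp (-(tailRate β * s ^ 2 / 2 + A * s + B)) ≤ skewTail C β γ s := by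
  set b := -min β 0 with hb
  have hb0 : 0 ≤ b := by simp [hb]
  set g := |γ|
  set D := C * (Real.sqrt (2 * Real.pi))⁻¹ ^ 2 with hD
  have hDpos : 0 < D := by positivity
  -- Coefficients read off from expanding (s + 1)²/2 + (b(s + 1) + g + 1)²/2 - log D, the exponent
  -- of a lower bound for the density on (s, s + 1].
  refine ⟨1 + b * (b + g + 1), 1 / 2 + (b + g + 1) ^ 2 / 2 - Real.log D, fun s hs => ?_⟩
  have hlow : ∀ z ∈ Set.Ioc s (s + 1),
      C * (stdNormalPDF (s + 1) * stdNormalPDF (b * (s + 1) + g + 1)) ≤ skewPDF C β γ z := by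
    intro z hz
    have hz0 : 0 ≤ z := hs.trans hz.1.le
    have h1 : stdNormalPDF (s + 1) ≤ stdNormalPDF z := by
      rw [stdNormalPDF_eq, stdNormalPDF_eq]
      gcongr
      exact hz.2
    have h2 : stdNormalPDF (b * (s + 1) + g + 1) ≤ stdNormalCDF (β * z + γ) := by
      refine (stdNormalPDF_le_stdNormalCDF (by positivity)).trans (monotone_stdNormalCDF ?_)
      have h3 : -b * (s + 1) ≤ -b * z := by nlinarith [hz.2]
      have h4 : -b * z ≤ β * z := by
        gcongr
        simp [hb]
      linarith [neg_abs_le γ]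
    have h5 := stdNormalPDF_pos (b * (s + 1) + g + 1)
    have h6 := stdNormalPDF_pos z
    unfold skewPDF
    gcongr
  calc Real.exp (-(tailRate β * s ^ 2 / 2 + (1 + b * (b + g + 1)) * s
        + (1 / 2 + (b + g + 1) ^ 2 / 2 - Real.log D)))
      = C * (stdNormalPDF (s + 1) * stdNormalPDF (b * (s + 1) + g + 1)) := by
        rw [stdNormalPDF_eq, stdNormalPDF_eq]
        have h1 : tailRate β = 1 + b ^ 2 := by simp [tailRate, hb]
        have h2 : -(tailRate β * s ^ 2 / 2 + (1 + b * (b + g + 1)) * s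
            + (1 / 2 + (b + g + 1) ^ 2 / 2 - Real.log D))
            = Real.log D + (-(s + 1) ^ 2 / 2 + -(b * (s + 1) + g + 1) ^ 2 / 2) := by
          rw [h1]
          ring
        rw [h2, Real.exp_add, Real.exp_log hDpos, Real.exp_add, hD]
        ring
    _ = ∫ _ in Set.Ioc s (s + 1),
          C * (stdNormalPDF (s + 1) * stdNormalPDF (b * (s + 1) + g + 1)) := by
        rw [setIntegral_const]
        simp
    _ ≤ ∫ z in Set.Ioc s (s + 1), skewPDF C β γ z :=
        setIntegral_mono_on (integrableOn_const measure_Ioc_lt_top.ne) integrable_skewPDF.integrableOn measurableSet_Ioc hlow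
    _ ≤ skewTail C β γ s :=
        setIntegral_mono_set integrable_skewPDF.integrableOn
          (Eventually.of_forall fun z => (skewPDF_pos hC z).le)
          Set.Ioc_subset_Ioi_self.eventuallyLE

end skew

/-! ### The density `normalPDF R` as a Gaussian law -/

section normal

variable {d : ℕ}

lemma pi_gaussianReal_eq_withDensity :
    Measure.pi (fun _ : Fin d => gaussianReal 0 1)
      = volume.withDensity (fun x => ENNReal.ofReal (∏ i, stdNormalPDF (x i))) := by
  refine (Measure.pi_eq fun s hs => ?_)
  rw [withDensity_apply _ (MeasurableSet.univ_pi hs), volume_pi, Measure.restrict_pi_pi,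
    ← ofReal_integral_eq_lintegral_ofReal,
    integral_fintype_prod_eq_prod (fun _ : Fin d => stdNormalPDF), ENNReal.ofReal_prod_of_nonneg]
  · exact Finset.prod_congr rfl fun i _ =>
      (gaussianReal_apply_eq_integral 0 one_ne_zero (s i)).symm
  · exact fun i _ => integral_nonneg fun z => (stdNormalPDF_pos z).le
  · exact Integrable.fintype_prod fun i => integrable_stdNormalPDF.integrableOn
  · exact Eventually.of_forall fun x => Finset.prod_nonneg fun i _ => (stdNormalPDF_pos (x i)).le

lemma prod_stdNormalPDF (y : Fin d → ℝ) :
    ∏ i, stdNormalPDF (y i)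
      = (Real.sqrt ((2 * Real.pi) ^ d))⁻¹ * Real.exp (-(y ⬝ᵥ y) / 2) := by
  simp only [stdNormalPDF_eq, Finset.prod_mul_distrib, Finset.prod_const, Finset.card_univ,
    Fintype.card_fin, ← Real.exp_sum, dotProduct]
  have h : Real.sqrt ((2 * Real.pi) ^ d) = Real.sqrt (2 * Real.pi) ^ d := by
    rw [Real.sqrt_eq_iff_mul_self_eq (by positivity) (by positivity), ← mul_pow,
      Real.mul_self_sqrt (by positivity)]
  rw [h, inv_pow, neg_div, Finset.sum_div, ← Finset.sum_neg_distrib]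
  simp only [sq, neg_div]

variable {R : Matrix (Fin d) (Fin d) ℝ}

lemma continuous_normalPDF : Continuous (normalPDF R) := by
  unfold normalPDF
  fun_prop

lemma normalPDF_mulVec {A : Matrix (Fin d) (Fin d) ℝ} (hA : A.IsSymm) (hAR : A * A = R)
    (hdet : A.det ≠ 0) (y : Fin d → ℝ) :
    |A.det| * normalPDF R (A *ᵥ y) = ∏ i, stdNormalPDF (y i) := by
  have hu : IsUnit A.det := hdet.isUnit
  have hR : R.det = A.det ^ 2 := by rw [← hAR, Matrix.det_mul, sq]
  have hq : (A *ᵥ y) ⬝ᵥ (R⁻¹ *ᵥ (A *ᵥ y)) = y ⬝ᵥ y := by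
    rw [← hAR, Matrix.mul_inv_rev, Matrix.mulVec_mulVec, mul_assoc, Matrix.nonsing_inv_mul _ hu,
      mul_one, Matrix.dotProduct_mulVec, ← hA.eq, Matrix.mulVec_transpose, Matrix.vecMul_vecMul,
      hA.eq, Matrix.mul_nonsing_inv _ hu, Matrix.vecMul_one]
  rw [normalPDF, hq, hR, prod_stdNormalPDF, Real.sqrt_mul (by positivity), Real.sqrt_sq_eq_abs]
  have := abs_ne_zero.2 hdet
  field_simp

/-- The centred normal distribution with covariance matrix `R`, given by its density. -/
def normalMeasure (R : Matrix (Fin d) (Fin d) ℝ) : Measure (Fin d → ℝ) :=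
  volume.withDensity (fun x => ENNReal.ofReal (normalPDF R x))

/-- Linear change of variables x = A y, where the Jacobian |det A| cancels the determinant in the
normalising constant. -/
lemma normalMeasure_eq_map_pi {A : Matrix (Fin d) (Fin d) ℝ} (hA : A.IsSymm) (hAR : A * A = R)
    (hdet : A.det ≠ 0) :
    normalMeasure R = (Measure.pi fun _ : Fin d => gaussianReal 0 1).map (A *ᵥ ·) := by
  have hm : Measurable (fun y : Fin d → ℝ => A *ᵥ y) :=
    (Continuous.measurable (by fun_prop))
  have hmap : Measure.map (fun y : Fin d → ℝ => A *ᵥ y) volume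
      = ENNReal.ofReal |(A.det)⁻¹| • volume :=
    Real.map_matrix_volume_pi_eq_smul_volume_pi hdet
  have hvol : (volume : Measure (Fin d → ℝ))
      = ENNReal.ofReal |A.det| • Measure.map (fun y : Fin d → ℝ => A *ᵥ y) volume := by
    rw [hmap, smul_smul, ← ENNReal.ofReal_mul (abs_nonneg _), ← abs_mul,
      mul_inv_cancel₀ hdet]
    simp
  have hc := continuous_normalPDF (R := R)
  ext s hs
  rw [normalMeasure, withDensity_apply _ hs, Measure.map_apply hm hs,
    pi_gaussianReal_eq_withDensity, withDensity_apply _ (hm hs), hvol, Measure.restrict_smul,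
    lintegral_smul_measure, setLIntegral_map hs (by fun_prop) hm, smul_eq_mul,
    ← lintegral_const_mul _ (by fun_prop), ← hvol]
  refine lintegral_congr fun y => ?_
  rw [← ENNReal.ofReal_mul (abs_nonneg _), normalPDF_mulVec hA hAR hdet]

open scoped MatrixOrder Matrix.Norms.L2Operator in
-- Both sides are the image of a product of standard Gaussians under the square root of R. This
-- makes the Gaussian mean, covariance and independence results available for the explicit density.
lemma normalMeasure_eq_map_multivariateGaussian (hR : R.PosDef) :
    normalMeasure R = (multivariateGaussian 0 R).map WithLp.ofLp := by
  have hsq : CFC.sqrt R * CFC.sqrt R = R := CFC.sqrt_mul_sqrt_self _ hR.posSemidef.nonneg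
  have hsymm : (CFC.sqrt R).IsSymm := by
    have h : IsSelfAdjoint (CFC.sqrt R) := (CFC.sqrt_nonneg R).isSelfAdjoint
    have h2 : (CFC.sqrt R)ᴴ = CFC.sqrt R := h
    rwa [Matrix.conjTranspose_eq_transpose_of_trivial] at h2
  have hdet : (CFC.sqrt R).det ≠ 0 := by
    intro h
    have := hR.det_pos
    rw [← hsq, Matrix.det_mul, h] at this
    simp at this
  rw [normalMeasure_eq_map_pi hsymm hsq hdet, multivariateGaussian, ← map_pi_eq_stdGaussian,
    Measure.map_map (by fun_prop) (by fun_prop), Measure.map_map (by fun_prop) (by fun_prop)]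
  congr 1
  ext y i
  simp

lemma isProbabilityMeasure_normalMeasure (hR : R.PosDef) :
    IsProbabilityMeasure (normalMeasure R) := by
  rw [normalMeasure_eq_map_multivariateGaussian hR]
  exact Measure.isProbabilityMeasure_map (by fun_prop)

lemma hasGaussianLaw_id_normalMeasure (hR : R.PosDef) :
    HasGaussianLaw (fun x => x) (normalMeasure R) where
  isGaussian_map := by
    rw [Measure.map_id', normalMeasure_eq_map_multivariateGaussian hR]
    exact (IsGaussian.hasGaussianLaw_id (μ := multivariateGaussian 0 R)).map
      (PiLp.continuousLinearEquiv 2 ℝ (fun _ : Fin d => ℝ)).toContinuousLinearMap |>.isGaussian_map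

/-- The linear functional `x ↦ a ⬝ᵥ x` as a continuous linear map. -/
def dotCLM (a : Fin d → ℝ) : (Fin d → ℝ) →L[ℝ] ℝ :=
  LinearMap.toContinuousLinearMap (dotProductBilin ℝ ℝ a)

lemma dotCLM_apply (a x : Fin d → ℝ) : dotCLM a x = a ⬝ᵥ x := rfl

lemma covariance_dotProduct_normalMeasure (hR : R.PosDef) (a b : Fin d → ℝ) :
    cov[fun x => a ⬝ᵥ x, fun x => b ⬝ᵥ x; normalMeasure R] = a ⬝ᵥ (R *ᵥ b) := by
  rw [normalMeasure_eq_map_multivariateGaussian hR,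
    covariance_map_fun (by fun_prop) (by fun_prop) (by fun_prop)]
  have h := covarianceBilin_multivariateGaussian (μ := 0) hR.posSemidef (WithLp.toLp 2 a)
    (WithLp.toLp 2 b)
  rw [covarianceBilin_apply_eq_cov IsGaussian.memLp_two_id] at h
  simpa [PiLp.inner_apply, dotProduct, mul_comm] using h

lemma integral_dotProduct_normalMeasure (hR : R.PosDef) (a : Fin d → ℝ) :
    ∫ x, a ⬝ᵥ x ∂(normalMeasure R) = 0 := by
  have h := (dotCLM a).integral_comp_comm (hasGaussianLaw_id_normalMeasure hR).integrable
  simp only [dotCLM_apply] at h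
  rw [h, normalMeasure_eq_map_multivariateGaussian hR, integral_map (by fun_prop) (by fun_prop)]
  have h2 := (PiLp.continuousLinearEquiv 2 ℝ (fun _ : Fin d => ℝ)).integral_comp_comm
    (μ := multivariateGaussian 0 R) (φ := fun x => x)
  rw [integral_id_multivariateGaussian] at h2
  have h3 : ∫ x, WithLp.ofLp x ∂(multivariateGaussian 0 R) = 0 := by simpa using! h2
  rw [h3, dotProduct_zero]

lemma hasLaw_dotProduct_normalMeasure (hR : R.PosDef) (a : Fin d → ℝ) :
    HasLaw (fun x => a ⬝ᵥ x) (gaussianReal 0 (a ⬝ᵥ (R *ᵥ a)).toNNReal) (normalMeasure R) where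
  aemeasurable := by fun_prop
  map_eq := by
    have h := ((hasGaussianLaw_id_normalMeasure hR).map_fun (dotCLM a)).map_eq_gaussianReal
    simp only [dotCLM_apply] at h
    rw [h, integral_dotProduct_normalMeasure hR, ← covariance_self (by fun_prop),
      covariance_dotProduct_normalMeasure hR]

/-- Jointly Gaussian functionals that are uncorrelated are independent. -/
lemma hasLaw_prod_dotProduct_normalMeasure (hR : R.PosDef) {a b : Fin d → ℝ}
    (hab : a ⬝ᵥ (R *ᵥ b) = 0) :
    HasLaw (fun x => (a ⬝ᵥ x, b ⬝ᵥ x))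
      ((gaussianReal 0 (a ⬝ᵥ (R *ᵥ a)).toNNReal).prod (gaussianReal 0 (b ⬝ᵥ (R *ᵥ b)).toNNReal))
      (normalMeasure R) := by
  have := isProbabilityMeasure_normalMeasure hR
  refine (indepFun_iff_hasLaw_prodMk_prod (hasLaw_dotProduct_normalMeasure hR a)
    (hasLaw_dotProduct_normalMeasure hR b)).1 ?_
  refine HasGaussianLaw.indepFun_of_covariance_eq_zero ?_ ?_
  · exact (hasGaussianLaw_id_normalMeasure hR).map_fun ((dotCLM a).prod (dotCLM b))
  · rw [covariance_dotProduct_normalMeasure hR, hab]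

end normal

/-! ### Exponential bound and Gaussian average of Φ -/

lemma stdNormalCDF_le_exp {c : ℝ} (hc : 0 ≤ c) (y : ℝ) :
    stdNormalCDF y ≤ Real.exp (c * y + c ^ 2 / 2) := by
  have h := measure_le_le_exp_mul_mgf (μ := gaussianReal 0 1) (X := id) (t := -c) y
    (neg_nonpos.2 hc) (by simpa using! integrable_exp_mul_gaussianReal (-c))
  rw [mgf_id_gaussianReal] at h
  rw [stdNormalCDF, cdf_eq_real]
  refine h.trans_eq ?_
  simp only [← Real.exp_add]
  congr 1
  simp

/-- With E standard normal independent of w, the left side is the probability that E - w ≤ y, and E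
- w has law N(0, 1 + v). -/
lemma lintegral_stdNormalCDF_add_gaussianReal (v : NNReal) (y : ℝ) :
    ∫⁻ w, ENNReal.ofReal (stdNormalCDF (w + y)) ∂(gaussianReal 0 v)
      = ENNReal.ofReal (stdNormalCDF (y / Real.sqrt (1 + v))) := by
  have hc := continuous_stdNormalCDF
  have hpos : 0 < Real.sqrt (1 + v) := by positivity
  have hneg : (gaussianReal 0 v).map (fun x => -x) = gaussianReal 0 v := by
    simpa using gaussianReal_map_neg (μ := 0) (v := v)
  have hS : MeasurableSet {p : ℝ × ℝ | p.1 + p.2 ≤ y} :=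
    measurableSet_le (by fun_prop) (by fun_prop)
  calc ∫⁻ w, ENNReal.ofReal (stdNormalCDF (w + y)) ∂(gaussianReal 0 v)
      = ∫⁻ w, gaussianReal 0 1 (Set.Iic (-w + y)) ∂(gaussianReal 0 v) := by
        nth_rewrite 1 [← hneg]
        rw [lintegral_map (by fun_prop) (by fun_prop)]
        simp_rw [ofReal_stdNormalCDF]
    _ = ((gaussianReal 0 v).prod (gaussianReal 0 1)) {p : ℝ × ℝ | p.1 + p.2 ≤ y} := by
        rw [Measure.prod_apply hS]
        refine lintegral_congr fun w => ?_
        congr 1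
        ext e
        simp only [Set.mem_Iic, Set.mem_preimage, Set.mem_ofPred_eq]
        constructor <;> intro h <;> linarith
    _ = (gaussianReal 0 (v + 1)) (Set.Iic y) := by
        have h := gaussianReal_conv_gaussianReal (m₁ := 0) (m₂ := 0) (v₁ := v) (v₂ := 1)
        rw [add_zero] at h
        rw [← h, Measure.conv, Measure.map_apply (by fun_prop) measurableSet_Iic]
        rfl
    _ = (gaussianReal 0 1) (Set.Iic (y / Real.sqrt (1 + v))) := by
        have h := gaussianReal_map_div_const (μ := 0) (v := v + 1) (Real.sqrt (1 + v))
        have hv : (v + 1) / NNReal.mk (Real.sqrt (1 + v) ^ 2) (sq_nonneg _) = 1 := by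
          have h1 : NNReal.mk (Real.sqrt (1 + v) ^ 2) (sq_nonneg _) = v + 1 := by
            ext
            rw [NNReal.coe_mk, Real.sq_sqrt (by positivity), NNReal.coe_add, NNReal.coe_one, add_comm]
          rw [h1, div_self (by positivity)]
        rw [hv, zero_div] at h
        rw [← h, Measure.map_apply (by fun_prop) measurableSet_Iic]
        congr 1
        ext z
        simp [div_le_div_iff_of_pos_right hpos]
    _ = _ := (ofReal_stdNormalCDF _).symm

/-! ### Chernoff bound and marginal laws of the extended skew-normal -/

section esn

variable {d : ℕ} {R : Matrix (Fin d) (Fin d) ℝ}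

/-- The normalising constant of the extended skew-normal density. -/
def esnConst (R : Matrix (Fin d) (Fin d) ℝ) (α : Fin d → ℝ) (τ : ℝ) : ℝ :=
  (stdNormalCDF (τ / Real.sqrt (1 + α ⬝ᵥ (R *ᵥ α))))⁻¹

lemma esnConst_pos (α : Fin d → ℝ) (τ : ℝ) : 0 < esnConst R α τ := inv_pos.2 (stdNormalCDF_pos _)

lemma esn_eq_withDensity (α : Fin d → ℝ) (τ : ℝ) :
    esn R α τ = (normalMeasure R).withDensity
      (fun x => ENNReal.ofReal (esnConst R α τ * stdNormalCDF (α ⬝ᵥ x + τ))) := by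
  have hc := continuous_stdNormalCDF
  have hn := continuous_normalPDF (R := R)
  rw [normalMeasure, ← withDensity_mul _ (by fun_prop) (by fun_prop), esn]
  congr 1
  ext x
  rw [Pi.mul_apply, ← ENNReal.ofReal_mul (by unfold normalPDF; positivity), esnPDF, esnConst]
  congr 1
  ring

lemma lintegral_exp_dotProduct_normalMeasure (hR : R.PosDef) (a : Fin d → ℝ) :
    ∫⁻ x, ENNReal.ofReal (Real.exp (a ⬝ᵥ x)) ∂(normalMeasure R)
      = ENNReal.ofReal (Real.exp (a ⬝ᵥ (R *ᵥ a) / 2)) := by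
  have h := (hasLaw_dotProduct_normalMeasure hR a).lintegral_comp
    (f := fun z => ENNReal.ofReal (Real.exp z)) (by fun_prop)
  rw [h]
  have hi := integrable_exp_mul_gaussianReal (μ := 0) (v := (a ⬝ᵥ (R *ᵥ a)).toNNReal) 1
  have hm := congrFun (mgf_id_gaussianReal (μ := 0) (v := (a ⬝ᵥ (R *ᵥ a)).toNNReal)) 1
  simp only [one_mul] at hi
  rw [← ofReal_integral_eq_lintegral_ofReal hi (Eventually.of_forall fun _ => (Real.exp_pos _).le)]
  simp only [mgf, id, one_mul] at hm
  rw [hm, Real.coe_toNNReal _ (by simpa using hR.posSemidef.dotProduct_mulVec_nonneg a)]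
  simp

/-- The variance form of `θ ⬝ᵥ X + c (α ⬝ᵥ X - E)`, with `E` standard normal noise. -/
def jointForm (R : Matrix (Fin d) (Fin d) ℝ) (α θ : Fin d → ℝ) (c : ℝ) : ℝ :=
  (θ + c • α) ⬝ᵥ (R *ᵥ (θ + c • α)) + c ^ 2

/-- A Chernoff bound for linear functionals of an extended skew-normal vector. -/
lemma esn_le_exp (hR : R.PosDef) (α : Fin d → ℝ) (τ : ℝ) (θ : Fin d → ℝ) {c : ℝ} (hc : 0 ≤ c)
    (r : ℝ) :
    esn R α τ {x | r ≤ θ ⬝ᵥ x} ≤ ENNReal.ofReal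
      (esnConst R α τ * Real.exp (c * τ + jointForm R α θ c / 2 - r)) := by
  have hcont := continuous_stdNormalCDF
  have hS : MeasurableSet {x : Fin d → ℝ | r ≤ θ ⬝ᵥ x} :=
    measurableSet_le (by fun_prop) (by fun_prop)
  have hK := (esnConst_pos (R := R) α τ).le
  rw [esn_eq_withDensity, withDensity_apply _ hS]
  calc ∫⁻ x in {x | r ≤ θ ⬝ᵥ x}, ENNReal.ofReal (esnConst R α τ * stdNormalCDF (α ⬝ᵥ x + τ))
        ∂(normalMeasure R)
      ≤ ∫⁻ x in {x | r ≤ θ ⬝ᵥ x}, ENNReal.ofReal (esnConst R α τ * Real.exp (c * τ + c ^ 2 / 2 - r))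
          * ENNReal.ofReal (Real.exp ((θ + c • α) ⬝ᵥ x)) ∂(normalMeasure R) := by
        -- On the event, exp(θᵀx - r) ≥ 1; multiplying by it and by the exponential bound for Φ
        -- leaves a pure Gaussian exponential moment.
        refine setLIntegral_mono (by fun_prop) fun x hx => ?_
        rw [← ENNReal.ofReal_mul (by positivity), mul_assoc, ← Real.exp_add]
        refine ENNReal.ofReal_le_ofReal (mul_le_mul_of_nonneg_left ?_ hK)
        refine (stdNormalCDF_le_exp hc _).trans (Real.exp_le_exp.2 ?_)
        rw [add_dotProduct, smul_dotProduct, smul_eq_mul]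
        have : r ≤ θ ⬝ᵥ x := hx
        linarith
    _ ≤ ∫⁻ x, ENNReal.ofReal (esnConst R α τ * Real.exp (c * τ + c ^ 2 / 2 - r))
          * ENNReal.ofReal (Real.exp ((θ + c • α) ⬝ᵥ x)) ∂(normalMeasure R) :=
        setLIntegral_le_lintegral _ _
    _ = _ := by
        rw [lintegral_const_mul _ (by fun_prop), lintegral_exp_dotProduct_normalMeasure hR,
          ← ENNReal.ofReal_mul (by positivity), mul_assoc, ← Real.exp_add, jointForm]
        congr 3
        ring

/-- The variance of the part of the latent variable not explained by the `i`-th coordinate. -/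
def residualVar (R : Matrix (Fin d) (Fin d) ℝ) (α : Fin d → ℝ) (i : Fin d) : ℝ :=
  1 + α ⬝ᵥ (R *ᵥ α) - (R *ᵥ α) i ^ 2

/-- The slant of the `i`-th marginal distribution. -/
def marginalSlant (R : Matrix (Fin d) (Fin d) ℝ) (α : Fin d → ℝ) (i : Fin d) : ℝ :=
  (R *ᵥ α) i / Real.sqrt (residualVar R α i)

lemma IsCorrelation.isSymm (hR : IsCorrelation R) : R.IsSymm := by
  have h : Rᴴ = R := hR.posDef.isHermitian
  rwa [Matrix.conjTranspose_eq_transpose_of_trivial] at h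

lemma dotProduct_mulVec_comm (hR : R.IsSymm) (a b : Fin d → ℝ) :
    a ⬝ᵥ (R *ᵥ b) = b ⬝ᵥ (R *ᵥ a) := by
  rw [Matrix.dotProduct_mulVec, ← Matrix.mulVec_transpose, hR.eq, dotProduct_comm]

/-- One Gram–Schmidt step for the inner product of R, in which e_i is a unit vector. -/
lemma residual_dotProduct (hR : IsCorrelation R) (α : Fin d → ℝ) (i : Fin d) :
    Pi.single i 1 ⬝ᵥ (R *ᵥ (α - (R *ᵥ α) i • Pi.single i 1)) = 0 ∧
    (α - (R *ᵥ α) i • Pi.single i 1) ⬝ᵥ (R *ᵥ (α - (R *ᵥ α) i • Pi.single i 1))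
      = residualVar R α i - 1 := by
  have h1 : (R *ᵥ (Pi.single i 1 : Fin d → ℝ)) i = 1 := by simp [hR.diag_one]
  have h2 : α ⬝ᵥ (R *ᵥ (Pi.single i 1 : Fin d → ℝ)) = (R *ᵥ α) i := by
    rw [dotProduct_mulVec_comm hR.isSymm]
    simp
  have h3 : Pi.single i 1 ⬝ᵥ (R *ᵥ (α - (R *ᵥ α) i • Pi.single i 1)) = 0 := by
    rw [single_one_dotProduct, Matrix.mulVec_sub, Matrix.mulVec_smul, Pi.sub_apply, Pi.smul_apply,
      h1]
    simp
  refine ⟨h3, ?_⟩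
  rw [sub_dotProduct, smul_dotProduct, h3, Matrix.mulVec_sub, Matrix.mulVec_smul, dotProduct_sub,
    dotProduct_smul, h2, residualVar]
  simp only [smul_eq_mul]
  ring

lemma one_le_residualVar (hR : IsCorrelation R) (α : Fin d → ℝ) (i : Fin d) :
    1 ≤ residualVar R α i := by
  have h := (residual_dotProduct hR α i).2
  have h2 := hR.posDef.posSemidef.dotProduct_mulVec_nonneg (α - (R *ᵥ α) i • Pi.single i 1)
  simp only [star_trivial] at h2
  linarith

/-- Write αᵀx = r x_i + bᵀx with bᵀx independent of x_i under the normal law, then average Φ over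
bᵀx. The factor √(1 + Var bᵀx) = √(`residualVar`) rescales the slant and the offset. -/
lemma esn_map_eval (hR : IsCorrelation R) (α : Fin d → ℝ) (τ : ℝ) (i : Fin d) :
    (esn R α τ).map (fun x => x i) = volume.withDensity (fun z => ENNReal.ofReal
      (skewPDF (esnConst R α τ) (marginalSlant R α i) (τ / Real.sqrt (residualVar R α i)) z)) := by
  set K := esnConst R α τ
  have hK : 0 ≤ K := (esnConst_pos (R := R) α τ).le
  set r := (R *ᵥ α) i
  set b := α - r • Pi.single i 1 with hb
  have hcont := continuous_stdNormalCDF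
  have hcont2 := continuous_stdNormalPDF
  obtain ⟨h1, h2⟩ := residual_dotProduct hR α i
  have hv := one_le_residualVar hR α i
  have hsqrt : Real.sqrt (1 + ((b ⬝ᵥ (R *ᵥ b)).toNNReal : ℝ))
      = Real.sqrt (residualVar R α i) := by
    rw [h2, Real.coe_toNNReal _ (by linarith)]
    congr 1
    ring
  have hlaw := hasLaw_prod_dotProduct_normalMeasure hR.posDef h1
  have hone : Pi.single i 1 ⬝ᵥ (R *ᵥ Pi.single i 1) = 1 := by simp [hR.diag_one]
  rw [hone, Real.toNNReal_one] at hlaw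
  ext A hA
  have hpre : MeasurableSet ((fun x : Fin d → ℝ => x i) ⁻¹' A) := hA.preimage (by fun_prop)
  rw [Measure.map_apply (by fun_prop) hA, esn_eq_withDensity, withDensity_apply _ hpre,
    withDensity_apply _ hA]
  let g : ℝ × ℝ → ENNReal := fun p =>
    A.indicator 1 p.1 * ENNReal.ofReal (K * stdNormalCDF (p.2 + (r * p.1 + τ)))
  have hg : Measurable g := by
    refine Measurable.mul ?_ (by fun_prop)
    exact (measurable_one.indicator hA).comp measurable_fst
  calc ∫⁻ x in (fun x => x i) ⁻¹' A, ENNReal.ofReal (K * stdNormalCDF (α ⬝ᵥ x + τ))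
        ∂(normalMeasure R)
      = ∫⁻ x, g (Pi.single i 1 ⬝ᵥ x, b ⬝ᵥ x) ∂(normalMeasure R) := by
        rw [← lintegral_indicator hpre]
        refine lintegral_congr fun x => ?_
        have h3 : b ⬝ᵥ x + (r * x i + τ) = α ⬝ᵥ x + τ := by
          rw [hb, sub_dotProduct, smul_dotProduct, single_one_dotProduct, smul_eq_mul]
          ring
        simp only [g, single_one_dotProduct, h3]
        by_cases hx : x i ∈ A <;> simp [hx]
    _ = ∫⁻ p, g p ∂((gaussianReal 0 1).prod (gaussianReal 0 (b ⬝ᵥ (R *ᵥ b)).toNNReal)) :=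
        hlaw.lintegral_comp hg.aemeasurable
    _ = ∫⁻ z, A.indicator 1 z * ENNReal.ofReal (K * stdNormalCDF
          (marginalSlant R α i * z + τ / Real.sqrt (residualVar R α i))) ∂(gaussianReal 0 1) := by
        rw [lintegral_prod _ hg.aemeasurable]
        refine lintegral_congr fun z => ?_
        simp only [g, ENNReal.ofReal_mul hK]
        rw [lintegral_const_mul _ (by fun_prop), lintegral_const_mul _ (by fun_prop),
          lintegral_stdNormalCDF_add_gaussianReal, hsqrt, add_div, marginalSlant, div_mul_eq_mul_div]
    _ = _ := by
        have hm : Measurable (fun z => A.indicator (1 : ℝ → ENNReal) z *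
            ENNReal.ofReal (K * stdNormalCDF
              (marginalSlant R α i * z + τ / Real.sqrt (residualVar R α i)))) :=
          (measurable_one.indicator hA).mul (by fun_prop)
        rw [gaussianReal_of_var_ne_zero _ one_ne_zero, lintegral_withDensity_eq_lintegral_mul _
          (by fun_prop) hm, ← lintegral_indicator hA]
        refine lintegral_congr fun z => ?_
        by_cases hz : z ∈ A
        · simp only [Pi.mul_apply, hz, Set.indicator_of_mem, Pi.one_apply, one_mul, gaussianPDF,
            skewPDF]
          rw [← ENNReal.ofReal_mul (gaussianPDFReal_nonneg _ _ _)]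
          congr 1
          ring
        · simp [hz]

lemma esn_setOf_lt (hR : IsCorrelation R) (α : Fin d → ℝ) (τ : ℝ) (i : Fin d) (s : ℝ) :
    esn R α τ {x | s < x i} = ENNReal.ofReal
      (skewTail (esnConst R α τ) (marginalSlant R α i) (τ / Real.sqrt (residualVar R α i)) s) := by
  have h : {x : Fin d → ℝ | s < x i} = (fun x => x i) ⁻¹' Set.Ioi s := rfl
  rw [h, ← Measure.map_apply (by fun_prop) measurableSet_Ioi, esn_map_eval hR,
    withDensity_apply _ measurableSet_Ioi, skewTail,
    ofReal_integral_eq_lintegral_ofReal integrable_skewPDF.integrableOn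
      (Eventually.of_forall fun z => (skewPDF_pos (esnConst_pos α τ) z).le)]

end esn

/-! ### Joint exceedances are of smaller order than marginal ones -/

section joint

variable {d : ℕ} {R : Matrix (Fin d) (Fin d) ℝ}

lemma jointForm_eq (hR : R.IsSymm) (α θ : Fin d → ℝ) (c : ℝ) :
    jointForm R α θ c
      = θ ⬝ᵥ (R *ᵥ θ) + 2 * c * (θ ⬝ᵥ (R *ᵥ α)) + c ^ 2 * (1 + α ⬝ᵥ (R *ᵥ α)) := by
  rw [jointForm, Matrix.mulVec_add, Matrix.mulVec_smul, add_dotProduct, dotProduct_add,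
    dotProduct_add, smul_dotProduct, smul_dotProduct, dotProduct_smul, dotProduct_smul,
    dotProduct_mulVec_comm hR α θ]
  simp only [smul_eq_mul]
  ring

lemma jointForm_smul (α θ : Fin d → ℝ) (c h : ℝ) :
    jointForm R α (h • θ) (h * c) = h ^ 2 * jointForm R α θ c := by
  have : h • θ + (h * c) • α = h • (θ + c • α) := by rw [smul_add, smul_smul]
  rw [jointForm, this, Matrix.mulVec_smul, smul_dotProduct, dotProduct_smul, jointForm]
  simp only [smul_eq_mul]
  ring

lemma jointForm_add_add_sub (α θ η : Fin d → ℝ) (b c : ℝ) :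
    jointForm R α (θ + η) (b + c) + jointForm R α (θ - η) (b - c)
      = 2 * jointForm R α θ b + 2 * jointForm R α η c := by
  have h1 : θ + η + (b + c) • α = (θ + b • α) + (η + c • α) := by module
  have h2 : θ - η + (b - c) • α = (θ + b • α) - (η + c • α) := by module
  simp only [jointForm, h1, h2, Matrix.mulVec_add, Matrix.mulVec_sub, add_dotProduct,
    dotProduct_add, sub_dotProduct, dotProduct_sub]
  ring

lemma jointForm_pos (hR : R.PosDef) (α : Fin d → ℝ) {θ : Fin d → ℝ} (hθ : θ ≠ 0) (c : ℝ) :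
    0 < jointForm R α θ c := by
  by_cases hc : c = 0
  · have h := hR.dotProduct_mulVec_pos hθ
    simpa [jointForm, hc] using h
  · have h := hR.posSemidef.dotProduct_mulVec_nonneg (θ + c • α)
    simp only [star_trivial] at h
    have : 0 < c ^ 2 := by positivity
    unfold jointForm
    linarith

/-- The weight on the latent variable minimising the form at the `i`-th coordinate functional. -/
def latentWeight (R : Matrix (Fin d) (Fin d) ℝ) (α : Fin d → ℝ) (i : Fin d) : ℝ :=
  -min ((R *ᵥ α) i) 0 / (1 + α ⬝ᵥ (R *ᵥ α))

lemma one_add_dotProduct_pos (hR : R.PosDef) (α : Fin d → ℝ) : 0 < 1 + α ⬝ᵥ (R *ᵥ α) := by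
  have h := hR.posSemidef.dotProduct_mulVec_nonneg α
  simp only [star_trivial] at h
  linarith

lemma latentWeight_nonneg (hR : R.PosDef) (α : Fin d → ℝ) (i : Fin d) :
    0 ≤ latentWeight R α i :=
  div_nonneg (neg_nonneg.2 (min_le_right _ _)) (one_add_dotProduct_pos hR α).le

/-- The optimal Chernoff exponent matches the true marginal decay rate. Minimising 1 + 2cr + c²v,
with r = (Rα)_i and v = 1 + αᵀRα, over c ≥ 0 gives 1 if r ≥ 0 and 1 - r²/v otherwise. -/
lemma tailRate_mul_jointForm (hR : IsCorrelation R) (α : Fin d → ℝ) (i : Fin d) :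
    tailRate (marginalSlant R α i) * jointForm R α (Pi.single i 1) (latentWeight R α i) = 1 := by
  have hone : Pi.single i 1 ⬝ᵥ (R *ᵥ Pi.single i 1) = 1 := by simp [hR.diag_one]
  have hv := one_add_dotProduct_pos hR.posDef α
  have hres := one_le_residualVar hR α i
  have hs : 0 < Real.sqrt (residualVar R α i) := by positivity
  rw [jointForm_eq hR.isSymm, hone, single_one_dotProduct, tailRate, latentWeight, marginalSlant]
  rcases le_or_gt 0 ((R *ᵥ α) i) with hr | hr
  · rw [min_eq_right (div_nonneg hr hs.le), min_eq_right hr]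
    simp
  · rw [min_eq_left (div_nonpos_of_nonpos_of_nonneg hr.le hs.le), min_eq_left hr.le, div_pow,
      Real.sq_sqrt (by linarith)]
    have hres0 : residualVar R α i ≠ 0 := by linarith
    have hdef : 1 + α ⬝ᵥ (R *ᵥ α) = residualVar R α i + (R *ᵥ α) i ^ 2 := by
      rw [residualVar]
      ring
    rw [hdef] at hv ⊢
    have hv' := hv.ne'
    field_simp
    ring

/-- The survival function of the `i`-th marginal. -/
def marginalTail (R : Matrix (Fin d) (Fin d) ℝ) (α : Fin d → ℝ) (τ : ℝ) (i : Fin d) (s : ℝ) : ℝ :=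
  skewTail (esnConst R α τ) (marginalSlant R α i) (τ / Real.sqrt (residualVar R α i)) s

/-- The joint event implies √κ_i x_i + √κ_j x_j ≥ r. The parallelogram law makes the form of this
functional strictly less than 4, hence the gain over exp(-r²/8). -/
lemma exists_joint_exp_bound (hR : IsCorrelation R) (α : Fin d → ℝ) (τ : ℝ) {i j : Fin d}
    (hij : i ≠ j) :
    ∃ q > 0, ∃ a : ℝ, ∀ s t, 0 ≤ s → 0 ≤ t →
      ∀ r, r = Real.sqrt (tailRate (marginalSlant R α i)) * s
        + Real.sqrt (tailRate (marginalSlant R α j)) * t →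
      esn R α τ {x | s ≤ x i ∧ t ≤ x j}
        ≤ ENNReal.ofReal (esnConst R α τ * Real.exp (a * r - r ^ 2 / 8 - q * r ^ 2)) := by
  set k := fun l => Real.sqrt (tailRate (marginalSlant R α l))
  have hk0 : ∀ l, 0 < k l := fun l => Real.sqrt_pos.2 (tailRate_pos _)
  set w := latentWeight R α
  have hw0 : ∀ l, 0 ≤ w l := latentWeight_nonneg hR.posDef α
  have hF : ∀ l, jointForm R α (k l • Pi.single l 1) (k l * w l) = 1 := fun l => by
    rw [jointForm_smul, Real.sq_sqrt (tailRate_pos _).le, tailRate_mul_jointForm hR]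
  have hne : k i • (Pi.single i 1 : Fin d → ℝ) - k j • Pi.single j 1 ≠ 0 := by
    intro h
    have := congrFun h i
    simp [hij] at this
    exact (hk0 i).ne' this
  have hpos := jointForm_pos hR.posDef α hne (k i * w i - k j * w j)
  have hpar := jointForm_add_add_sub (R := R) α (k i • Pi.single i 1) (k j • Pi.single j 1)
    (k i * w i) (k j * w j)
  rw [hF i, hF j] at hpar
  set q := jointForm R α (k i • Pi.single i 1 - k j • Pi.single j 1) (k i * w i - k j * w j)
  set θ := k i • (Pi.single i 1 : Fin d → ℝ) + k j • Pi.single j 1 with hθ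
  set c := k i * w i + k j * w j
  have hc0 : 0 ≤ c := add_nonneg (mul_nonneg (hk0 i).le (hw0 i)) (mul_nonneg (hk0 j).le (hw0 j))
  -- Chernoff parameter r/4, optimal for form value 4: the exponent is (r/4)²(4 - q)/2 - r²/4 =
  -- -r²/8 - q r²/32, plus (r/4)cτ.
  refine ⟨q / 32, by positivity, c * τ / 4, fun s t hs ht r hr => ?_⟩
  have hr0 : 0 ≤ r := hr ▸ add_nonneg (mul_nonneg (hk0 i).le hs) (mul_nonneg (hk0 j).le ht)
  have hdot : ∀ x : Fin d → ℝ, ((r / 4) • θ) ⬝ᵥ x = r / 4 * (k i * x i + k j * x j) := fun x => by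
    simp [hθ, add_dotProduct, smul_dotProduct, mul_add]
  have hrc : 0 ≤ r / 4 * c := by positivity
  refine (measure_mono fun x hx => ?_).trans
    ((esn_le_exp hR.posDef α τ ((r / 4) • θ) hrc (r / 4 * r)).trans_eq ?_)
  · have h1 : r ≤ k i * x i + k j * x j := by
      rw [hr]
      exact add_le_add (mul_le_mul_of_nonneg_left hx.1 (hk0 i).le)
        (mul_le_mul_of_nonneg_left hx.2 (hk0 j).le)
    show r / 4 * r ≤ ((r / 4) • θ) ⬝ᵥ x
    rw [hdot]
    exact mul_le_mul_of_nonneg_left h1 (by positivity)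
  · have h4 : jointForm R α θ c = 4 - q := by linarith
    rw [jointForm_smul, h4]
    congr 3
    ring

lemma marginalTail_pos (α : Fin d → ℝ) (τ : ℝ) (i : Fin d) (s : ℝ) :
    0 < marginalTail R α τ i s := by
  have hanti : StrictAnti (marginalTail R α τ i) :=
    strictAnti_of_hasDerivAt_neg (fun t => hasDerivAt_skewTail t)
      fun t => neg_neg_of_pos (skewPDF_pos (esnConst_pos α τ) t)
  refine lt_of_le_of_lt ?_ (hanti (show s < s + 1 by linarith))
  exact setIntegral_nonneg measurableSet_Ioi fun z _ => (skewPDF_pos (esnConst_pos α τ) z).le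

/-- Joint exceedances of two coordinates are negligible compared with single exceedances. -/
lemma joint_exceedance_negligible (hR : IsCorrelation R) (α : Fin d → ℝ) (τ : ℝ) {i j : Fin d}
    (hij : i ≠ j) {ε : ℝ} (hε : 0 < ε) :
    ∃ S : ℝ, ∀ s t, S ≤ s → S ≤ t → esn R α τ {x | s ≤ x i ∧ t ≤ x j}
      ≤ ENNReal.ofReal (ε * max (marginalTail R α τ i s) (marginalTail R α τ j t)) := by
  obtain ⟨q, hq, a, hqa⟩ := exists_joint_exp_bound hR α τ hij
  have hK := esnConst_pos (R := R) α τ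
  obtain ⟨A₁, B₁, h₁⟩ := exists_exp_le_skewTail (β := marginalSlant R α i)
    (γ := τ / Real.sqrt (residualVar R α i)) hK
  obtain ⟨A₂, B₂, h₂⟩ := exists_exp_le_skewTail (β := marginalSlant R α j)
    (γ := τ / Real.sqrt (residualVar R α j)) hK
  set A := |A₁| + |A₂|
  set B := |B₁| + |B₂|
  have hlim : Tendsto (fun r : ℝ => esnConst R α τ * Real.exp (B + r * ((a + A) - q * r)))
      atTop (𝓝 0) := by
    have h1 : Tendsto (fun r : ℝ => (a + A) - q * r) atTop atBot :=
      tendsto_atBot_add_const_left _ _ (tendsto_neg_atTop_atBot.comp (tendsto_id.const_mul_atTop hq))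
    have h2 : Tendsto (fun r : ℝ => B + r * ((a + A) - q * r)) atTop atBot :=
      tendsto_atBot_add_const_left _ _ (tendsto_id.atTop_mul_atBot₀ h1)
    simpa using (Real.tendsto_exp_atBot.comp h2).const_mul (esnConst R α τ)
  obtain ⟨r₀, hr₀⟩ := eventually_atTop.1 (hlim.eventually (gt_mem_nhds hε))
  refine ⟨max r₀ 0, fun s t hs ht => ?_⟩
  have hs0 : 0 ≤ s := (le_max_right _ _).trans hs
  have ht0 : 0 ≤ t := (le_max_right _ _).trans ht
  have hk : ∀ l, 1 ≤ Real.sqrt (tailRate (marginalSlant R α l)) := fun l => by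
    rw [Real.one_le_sqrt, tailRate]
    nlinarith [sq_nonneg (min (marginalSlant R α l) 0)]
  have hk2 : ∀ l, Real.sqrt (tailRate (marginalSlant R α l)) ^ 2
      = tailRate (marginalSlant R α l) := fun l => Real.sq_sqrt (tailRate_pos _).le
  obtain ⟨r, hr⟩ : ∃ r, r = Real.sqrt (tailRate (marginalSlant R α i)) * s
        + Real.sqrt (tailRate (marginalSlant R α j)) * t := ⟨_, rfl⟩
  refine (hqa s t hs0 ht0 r hr).trans (ENNReal.ofReal_le_ofReal ?_)
  have hsle : s ≤ Real.sqrt (tailRate (marginalSlant R α i)) * s := by nlinarith [hk i]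
  have htle : t ≤ Real.sqrt (tailRate (marginalSlant R α j)) * t := by nlinarith [hk j]
  have hrr : r₀ ≤ r := by linarith [le_max_left r₀ 0]
  have hmax : Real.exp (-(r ^ 2 / 8 + A * r + B))
      ≤ max (marginalTail R α τ i s) (marginalTail R α τ j t) := by
    have key : ∀ (l : Fin d) (z A' B' : ℝ), 0 ≤ z → |A'| ≤ A → |B'| ≤ B →
        Real.sqrt (tailRate (marginalSlant R α l)) * z ≤ r / 2 →
        Real.exp (-(r ^ 2 / 8 + A * r + B))
          ≤ Real.exp (-(tailRate (marginalSlant R α l) * z ^ 2 / 2 + A' * z + B')) := by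
      intro l z A' B' hz hA hB hzr
      have hzle : z ≤ Real.sqrt (tailRate (marginalSlant R α l)) * z := by nlinarith [hk l]
      have h5 : tailRate (marginalSlant R α l) * z ^ 2 ≤ (r / 2) ^ 2 := by
        rw [← hk2 l, ← mul_pow]
        exact pow_le_pow_left₀ (by positivity) hzr 2
      have h6 : A' * z ≤ A * r :=
        mul_le_mul ((le_abs_self _).trans hA) (by linarith) hz ((abs_nonneg _).trans hA)
      have h7 : B' ≤ B := (le_abs_self _).trans hB
      apply Real.exp_le_exp.2
      linarith
    -- The smaller of the two summands of r is at most r/2, so its marginal tail decays no faster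
    -- than exp(-r²/8) up to lower-order terms in the exponent.
    rcases le_total (Real.sqrt (tailRate (marginalSlant R α i)) * s)
      (Real.sqrt (tailRate (marginalSlant R α j)) * t) with h | h
    · exact le_max_of_le_left ((key i s A₁ B₁ hs0 (le_add_of_nonneg_right (abs_nonneg _))
        (le_add_of_nonneg_right (abs_nonneg _)) (by linarith)).trans (h₁ s hs0))
    · exact le_max_of_le_right ((key j t A₂ B₂ ht0 (le_add_of_nonneg_left (abs_nonneg _))
        (le_add_of_nonneg_left (abs_nonneg _)) (by linarith)).trans (h₂ t ht0))
  calc esnConst R α τ * Real.exp (a * r - r ^ 2 / 8 - q * r ^ 2)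
      = esnConst R α τ * Real.exp (B + r * ((a + A) - q * r))
          * Real.exp (-(r ^ 2 / 8 + A * r + B)) := by
        rw [mul_assoc, ← Real.exp_add]
        congr 2
        ring
    _ ≤ ε * max (marginalTail R α τ i s) (marginalTail R α τ j t) :=
        mul_le_mul (hr₀ r hrr).le hmax (Real.exp_pos _).le hε.le

end joint

/-! ### Marginal quantiles and tail dependence -/

section limits

variable {d : ℕ} {R : Matrix (Fin d) (Fin d) ℝ} {α : Fin d → ℝ} {τ : ℝ}

lemma hasDerivAt_marginalTail (i : Fin d) (t : ℝ) :
    HasDerivAt (marginalTail R α τ i) (-skewPDF (esnConst R α τ) (marginalSlant R α i)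
      (τ / Real.sqrt (residualVar R α i)) t) t :=
  hasDerivAt_skewTail t

lemma strictAnti_marginalTail (i : Fin d) : StrictAnti (marginalTail R α τ i) :=
  strictAnti_of_hasDerivAt_neg (hasDerivAt_marginalTail i)
    fun t => neg_neg_of_pos (skewPDF_pos (esnConst_pos α τ) t)

lemma continuous_marginalTail (i : Fin d) : Continuous (marginalTail R α τ i) :=
  continuous_iff_continuousAt.2 fun t => (hasDerivAt_marginalTail i t).continuousAt

lemma tendsto_marginalTail_atTop (i : Fin d) : Tendsto (marginalTail R α τ i) atTop (𝓝 0) :=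
  tendsto_skewTail_atTop

lemma exists_marginalTail_eq (i : Fin d) {S u : ℝ} (hu : 0 < u)
    (huS : u ≤ marginalTail R α τ i S) : ∃ s, S ≤ s ∧ marginalTail R α τ i s = u := by
  obtain ⟨T, hT, hST⟩ := (((tendsto_marginalTail_atTop (R := R) (α := α) (τ := τ) i).eventually
    (gt_mem_nhds hu)).and (eventually_ge_atTop S)).exists
  obtain ⟨s, hs, hsu⟩ := intermediate_value_Icc' hST
    (continuous_marginalTail (R := R) (α := α) (τ := τ) i).continuousOn ⟨hT.le, huS⟩
  exact ⟨s, hs.1, hsu⟩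

lemma esn_real_setOf_lt (hR : IsCorrelation R) (i : Fin d) (s : ℝ) :
    (esn R α τ).real {x | s < x i} = marginalTail R α τ i s := by
  rw [measureReal_def, esn_setOf_lt hR, ENNReal.toReal_ofReal]
  · rfl
  · exact (marginalTail_pos α τ i s).le

lemma esn_real_joint_le (hR : IsCorrelation R) {i j : Fin d} (hij : i ≠ j) {ε : ℝ} (hε : 0 < ε) :
    ∃ S : ℝ, ∀ s t, S ≤ s → S ≤ t → (esn R α τ).real {x | s ≤ x i ∧ t ≤ x j}
      ≤ ε * max (marginalTail R α τ i s) (marginalTail R α τ j t) := by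
  obtain ⟨S, hS⟩ := joint_exceedance_negligible hR α τ hij hε
  refine ⟨S, fun s t hs ht => ENNReal.toReal_le_of_le_ofReal ?_ (hS s t hs ht)⟩
  exact mul_nonneg hε.le (le_max_of_le_left (marginalTail_pos α τ i s).le)

lemma cdf_map_eval (hR : IsCorrelation R) {Ω : Type*} [MeasurableSpace Ω] {P : Measure Ω}
    [IsProbabilityMeasure P] {X : Ω → Fin d → ℝ} (hX : HasLaw X (esn R α τ) P) (i : Fin d)
    (s : ℝ) : cdf (P.map fun ω => X ω i) s = 1 - marginalTail R α τ i s := by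
  have hμ : IsProbabilityMeasure (esn R α τ) := hX.isProbabilityMeasure_iff.1 inferInstance
  have hXi : AEMeasurable (fun ω => X ω i) P :=
    (measurable_pi_apply i).comp_aemeasurable hX.aemeasurable
  have := Measure.isProbabilityMeasure_map hXi
  have hmap : (P.map fun ω => X ω i) = (esn R α τ).map (fun x => x i) := by
    rw [← hX.map_eq, AEMeasurable.map_map_of_aemeasurable (measurable_pi_apply i).aemeasurable hX.aemeasurable]
    rfl
  have hS : MeasurableSet {x : Fin d → ℝ | s < x i} :=
    measurableSet_lt measurable_const (measurable_pi_apply i)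
  rw [cdf_eq_real, hmap, map_measureReal_apply (by fun_prop) measurableSet_Iic,
    ← esn_real_setOf_lt hR, ← probReal_compl_eq_one_sub hS]
  congr 1
  ext x
  simp

/-- Any two coordinates of an extended skew-normal vector are asymptotically independent in the
upper tail. -/
lemma tendsto_tailDependence (hR : IsCorrelation R) {Ω : Type*} [MeasurableSpace Ω] {P : Measure Ω}
    [IsProbabilityMeasure P] {X : Ω → Fin d → ℝ} (hX : HasLaw X (esn R α τ) P) {i j : Fin d}
    (hij : i ≠ j) :
    Tendsto (tailDependence P (fun ω => X ω i) (fun ω => X ω j)) (𝓝[>] 0) (𝓝 0) := by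
  have hnonneg : ∀ᶠ u in 𝓝[>] (0 : ℝ),
      0 ≤ tailDependence P (fun ω => X ω i) (fun ω => X ω j) u := by
    filter_upwards [self_mem_nhdsWithin] with u hu
    exact div_nonneg measureReal_nonneg (le_of_lt hu)
  refine tendsto_order.2 ⟨fun a ha => hnonneg.mono fun u hu => ha.trans_le hu, fun ε hε => ?_⟩
  obtain ⟨S, hS⟩ := esn_real_joint_le (α := α) (τ := τ) hR hij (half_pos hε)
  have hpos : 0 < min (marginalTail R α τ i S) (marginalTail R α τ j S) :=
    lt_min (marginalTail_pos α τ i S) (marginalTail_pos α τ j S)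
  -- For small u both levels with tail u lie beyond S, and the maximum of the two marginal tails is
  -- u itself.
  filter_upwards [Ioo_mem_nhdsGT hpos] with u hu
  obtain ⟨s, hs, hsu⟩ := exists_marginalTail_eq i hu.1 (hu.2.le.trans (min_le_left _ _))
  obtain ⟨t, ht, htu⟩ := exists_marginalTail_eq j hu.1 (hu.2.le.trans (min_le_right _ _))
  have hB : MeasurableSet {x : Fin d → ℝ | s ≤ x i ∧ t ≤ x j} :=
    (measurableSet_le measurable_const (measurable_pi_apply i)).inter
      (measurableSet_le measurable_const (measurable_pi_apply j))
  have h1 : P.real {ω | 1 - u ≤ cdf (P.map fun ω => X ω i) (X ω i) ∧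
      1 - u ≤ cdf (P.map fun ω => X ω j) (X ω j)} ≤ ε / 2 * u := by
    calc _ ≤ P.real {ω | s ≤ X ω i ∧ t ≤ X ω j} := by
          refine measureReal_mono fun ω hω => ?_
          obtain ⟨h1, h2⟩ := hω
          rw [cdf_map_eval hR hX] at h1 h2
          constructor
          · rw [← (strictAnti_marginalTail (R := R) (α := α) (τ := τ) i).le_iff_ge]
            linarith
          · rw [← (strictAnti_marginalTail (R := R) (α := α) (τ := τ) j).le_iff_ge]
            linarith
      _ = (esn R α τ).real {x | s ≤ x i ∧ t ≤ x j} := hX.measureReal_eq hB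
      _ ≤ ε / 2 * u := by
          have := hS s t hs ht
          rwa [hsu, htu, max_self] at this
  rw [tailDependence, div_lt_iff₀ hu.1]
  nlinarith [hu.1]

/-! ### Unions of rare events and sample maxima -/

/-- Bonferroni's lower bound for the probability of a union. -/
lemma sum_sub_sum_inter_le_measureReal_iUnion {E ι : Type*} [MeasurableSpace E] [Fintype ι]
    [DecidableEq ι] (μ : Measure E) [IsFiniteMeasure μ] {A : ι → Set E}
    (hA : ∀ i, MeasurableSet (A i)) :
    ∑ i, (μ.real (A i) - ∑ j ∈ Finset.univ.erase i, μ.real (A i ∩ A j)) ≤ μ.real (⋃ i, A i) := by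
  -- Points lying in exactly one of the sets. Each pair is subtracted twice, which is harmless as
  -- the pair terms vanish in the limit.
  let B : ι → Set E := fun i => A i \ ⋃ j ∈ Finset.univ.erase i, A j
  have hBm : ∀ i, MeasurableSet (B i) := fun i =>
    (hA i).diff (Finset.measurableSet_biUnion _ fun j _ => hA j)
  have hdisj : Pairwise (Function.onFun Disjoint B) := by
    intro i j hij
    refine Set.disjoint_left.2 fun x hx hy => hx.2 ?_
    simp only [Set.mem_iUnion]
    exact ⟨j, Finset.mem_erase.2 ⟨hij.symm, Finset.mem_univ _⟩, hy.1⟩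
  calc ∑ i, (μ.real (A i) - ∑ j ∈ Finset.univ.erase i, μ.real (A i ∩ A j))
      ≤ ∑ i, μ.real (B i) := by
        refine Finset.sum_le_sum fun i _ => ?_
        have h1 : μ.real (A i ∩ ⋃ j ∈ Finset.univ.erase i, A j)
            ≤ ∑ j ∈ Finset.univ.erase i, μ.real (A i ∩ A j) := by
          rw [Set.inter_iUnion₂]
          exact measureReal_biUnion_finset_le _ _
        have h2 := measureReal_inter_add_sdiff (μ := μ) (s := A i)
          (Finset.measurableSet_biUnion (Finset.univ.erase i) fun j _ => hA j)
        simp only [B]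
        linarith
    _ = μ.real (⋃ i, B i) := (measureReal_iUnion_fintype hdisj hBm).symm
    _ ≤ μ.real (⋃ i, A i) := measureReal_mono (Set.iUnion_mono fun i => Set.sdiff_subset)

lemma tendsto_mul_measureReal_iUnion {E ι : Type*} [MeasurableSpace E] [Fintype ι]
    (μ : Measure E) [IsFiniteMeasure μ] {A : ℕ → ι → Set E}
    (hA : ∀ n i, MeasurableSet (A n i)) {c : ι → ℝ}
    (h1 : ∀ i, Tendsto (fun n : ℕ => n * μ.real (A n i)) atTop (𝓝 (c i)))
    (h2 : ∀ i j, i ≠ j → Tendsto (fun n : ℕ => n * μ.real (A n i ∩ A n j)) atTop (𝓝 0)) :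
    Tendsto (fun n : ℕ => n * μ.real (⋃ i, A n i)) atTop (𝓝 (∑ i, c i)) := by
  classical
  have hup : Tendsto (fun n : ℕ => ∑ i, n * μ.real (A n i)) atTop (𝓝 (∑ i, c i)) :=
    tendsto_finsetSum _ fun i _ => h1 i
  have hlow : Tendsto (fun n : ℕ => ∑ i, (n * μ.real (A n i)
      - ∑ j ∈ Finset.univ.erase i, n * μ.real (A n i ∩ A n j))) atTop (𝓝 (∑ i, c i)) := by
    refine tendsto_finsetSum _ fun i _ => ?_
    have h3 : Tendsto (fun n : ℕ => ∑ j ∈ Finset.univ.erase i, n * μ.real (A n i ∩ A n j)) atTop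
        (𝓝 (∑ j ∈ Finset.univ.erase i, 0)) :=
      tendsto_finsetSum _ fun j hj => h2 i j (Finset.ne_of_mem_erase hj).symm
    simpa using (h1 i).sub h3
  refine tendsto_of_tendsto_of_tendsto_of_le_of_le hlow hup (fun n => ?_) (fun n => ?_)
  · have h := mul_le_mul_of_nonneg_left
      (sum_sub_sum_inter_le_measureReal_iUnion μ (hA n)) (Nat.cast_nonneg (α := ℝ) n)
    simpa only [Finset.mul_sum, mul_sub] using h
  · have h := mul_le_mul_of_nonneg_left
      (measureReal_iUnion_fintype_le (μ := μ) (A n)) (Nat.cast_nonneg (α := ℝ) n)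
    simpa only [Finset.mul_sum] using h

/-- The sample maxima stay below `u` if and only if all sampled vectors do. -/
lemma measureReal_sampleMax_le {Ω : Type*} [MeasurableSpace Ω] {P : Measure Ω}
    {μ : Measure (Fin d → ℝ)} {S : ℕ → Ω → Fin d → ℝ} (hS : ∀ m, HasLaw (S m) μ P)
    (hind : iIndepFun S P) {n : ℕ} (hn : n ≠ 0) (u : Fin d → ℝ) :
    P.real {ω | ∀ j, sampleMax S n j ω ≤ u j} = μ.real {x | ∀ j, x j ≤ u j} ^ n := by
  have hB : MeasurableSet {x : Fin d → ℝ | ∀ j, x j ≤ u j} := measurableSet_Iic (a := u)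
  have : Nonempty (Fin n) := ⟨⟨0, Nat.pos_of_ne_zero hn⟩⟩
  have hset : {ω | ∀ j, sampleMax S n j ω ≤ u j}
      = ⋂ m ∈ Finset.range n, S m ⁻¹' {x | ∀ j, x j ≤ u j} := by
    ext ω
    simp only [sampleMax, Set.mem_ofPred_eq, Set.mem_iInter, Finset.mem_range, Set.mem_preimage]
    constructor
    · intro h m hm j
      exact (le_ciSup (f := fun k : Fin n => S k ω j) (Set.finite_range _).bddAbove ⟨m, hm⟩).trans
        (h j)
    · exact fun h j => ciSup_le fun m => h m m.2 j
  rw [hset, measureReal_def, hind.measure_inter_preimage_eq_mul _ (fun _ _ => hB),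
    ENNReal.toReal_prod]
  have h : ∀ m, (P (S m ⁻¹' {x | ∀ j, x j ≤ u j})).toReal = μ.real {x | ∀ j, x j ≤ u j} :=
    fun m => (hS m).measureReal_eq hB
  simp only [h, Finset.prod_const, Finset.card_range]

/-- Quantiles of order `1 - 1 / n` of the marginals. -/
lemma exists_marginal_quantiles (R : Matrix (Fin d) (Fin d) ℝ) (α : Fin d → ℝ) (τ : ℝ) :
    ∃ b : ℕ → Fin d → ℝ, ∀ j, Tendsto (fun n => b n j) atTop atTop ∧
      ∀ᶠ n : ℕ in atTop, marginalTail R α τ j (b n j) = (n : ℝ)⁻¹ := by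
  have hex : ∀ (n : ℕ) (j : Fin d), ∃ b : ℝ, (0 < n ∧ (n : ℝ)⁻¹ ≤ marginalTail R α τ j 0) →
      marginalTail R α τ j b = (n : ℝ)⁻¹ := by
    intro n j
    by_cases h : 0 < n ∧ (n : ℝ)⁻¹ ≤ marginalTail R α τ j 0
    · obtain ⟨s, -, hs⟩ := exists_marginalTail_eq j (by have := h.1; positivity) h.2
      exact ⟨s, fun _ => hs⟩
    -- Arbitrary value for the finitely many n where 1/n is not a tail value attained on [0, ∞).
    · exact ⟨0, fun h' => absurd h' h⟩
  choose b hb using hex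
  have hinv : Tendsto (fun n : ℕ => (n : ℝ)⁻¹) atTop (𝓝 0) := tendsto_inv_atTop_nhds_zero_nat
  have heq : ∀ j, ∀ᶠ n : ℕ in atTop, marginalTail R α τ j (b n j) = (n : ℝ)⁻¹ := by
    intro j
    filter_upwards [eventually_gt_atTop 0,
      hinv.eventually (gt_mem_nhds (marginalTail_pos α τ j 0))] with n hn hle
    exact hb n j ⟨hn, hle.le⟩
  refine ⟨b, fun j => ⟨tendsto_atTop.2 fun M => ?_, heq j⟩⟩
  filter_upwards [heq j, hinv.eventually (gt_mem_nhds (marginalTail_pos α τ j M))] with n h1 h2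
  rw [← h1] at h2
  exact ((strictAnti_marginalTail j).lt_iff_gt.1 h2).le

/-- Exceedance probabilities over levels at which the expected number of marginal exceedances
converges: the multivariate limit is that of independent coordinates. -/
lemma tendsto_esn_real_orthant_pow (hR : IsCorrelation R) [IsProbabilityMeasure (esn R α τ)]
    {u : ℕ → Fin d → ℝ} {c : Fin d → ℝ} (hu : ∀ j, Tendsto (fun n => u n j) atTop atTop)
    (hc : ∀ j, Tendsto (fun n : ℕ => n * marginalTail R α τ j (u n j)) atTop (𝓝 (c j))) :
    Tendsto (fun n : ℕ => (esn R α τ).real {x | ∀ j, x j ≤ u n j} ^ n) atTop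
      (𝓝 (∏ j, Real.exp (-c j))) := by
  have hA : ∀ (n : ℕ) (j : Fin d), MeasurableSet {x : Fin d → ℝ | u n j < x j} := fun n j =>
    measurableSet_lt measurable_const (measurable_pi_apply j)
  have hunion := tendsto_mul_measureReal_iUnion (esn R α τ) (A := fun n j => {x | u n j < x j}) hA
    (c := c) (by simpa only [esn_real_setOf_lt hR] using hc) (fun i j hij => ?_)
  · have hcompl : ∀ n, (esn R α τ).real {x | ∀ j, x j ≤ u n j}
        = 1 + -(esn R α τ).real (⋃ j, {x | u n j < x j}) := by
      intro n
      rw [← sub_eq_add_neg, ← probReal_compl_eq_one_sub (MeasurableSet.iUnion (hA n))]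
      congr 1
      ext x
      simp
    simp_rw [hcompl, ← Real.exp_sum, Finset.sum_neg_distrib]
    refine Real.tendsto_one_add_pow_exp_of_tendsto ?_
    simpa only [mul_neg] using hunion.neg
  -- Pair terms: n times the larger marginal tail stays bounded, and the joint probability is an
  -- arbitrarily small multiple of that tail. Using |M| + 1 keeps the divisor positive.
  · have hmax := (hc i).max (hc j)
    have hnonneg : ∀ n : ℕ, 0 ≤ n * (esn R α τ).real ({x | u n i < x i} ∩ {x | u n j < x j}) :=
      fun n => by positivity
    refine tendsto_order.2
      ⟨fun a ha => Eventually.of_forall fun n => ha.trans_le (hnonneg n), fun ε hε => ?_⟩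
    set M := max (c i) (c j)
    have hM : M < |M| + 1 := by linarith [le_abs_self M]
    have hpos : 0 < |M| + 1 := by positivity
    obtain ⟨S, hS⟩ := esn_real_joint_le (α := α) (τ := τ) hR hij (div_pos hε hpos)
    filter_upwards [hmax.eventually (gt_mem_nhds hM), (hu i).eventually_ge_atTop S,
      (hu j).eventually_ge_atTop S] with n h1 h2 h3
    have h4 : (esn R α τ).real ({x | u n i < x i} ∩ {x | u n j < x j})
        ≤ ε / (|M| + 1) * max (marginalTail R α τ i (u n i)) (marginalTail R α τ j (u n j)) := by
      refine le_trans (measureReal_mono fun x hx => ?_) (hS _ _ h2 h3)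
      exact ⟨le_of_lt hx.1, le_of_lt hx.2⟩
    calc (n : ℝ) * (esn R α τ).real ({x | u n i < x i} ∩ {x | u n j < x j})
        ≤ n * (ε / (|M| + 1)
            * max (marginalTail R α τ i (u n i)) (marginalTail R α τ j (u n j))) := by gcongr
      _ = ε / (|M| + 1) * max (n * marginalTail R α τ i (u n i))
            (n * marginalTail R α τ j (u n j)) := by
          rw [← mul_max_of_nonneg _ _ (Nat.cast_nonneg n)]
          ring
      _ < ε / (|M| + 1) * (|M| + 1) := mul_lt_mul_of_pos_left h1 (div_pos hε hpos)
      _ = ε := by field_simp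

end limits

end ExtSkewNormal

end

/-! ### The theorem, with explicit scale constants -/

theorem proposition1 {d : ℕ} (R : Matrix (Fin d) (Fin d) ℝ) (hR : ExtSkewNormal.IsCorrelation R)
    (α : Fin d → ℝ) (τ : ℝ)
    {Ω : Type*} [MeasurableSpace Ω] (P : Measure Ω) [IsProbabilityMeasure P]
    (X : Ω → Fin d → ℝ) (hX : HasLaw X (ExtSkewNormal.esn R α τ) P) :
    (∀ i j : Fin d, i < j →
      Tendsto (fun u : ℝ =>
          ExtSkewNormal.tailDependence P (fun ω => X ω i) (fun ω => X ω j) u)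
        (𝓝[>] 0) (𝓝 0)) ∧
    ∃ a b : ℕ → Fin d → ℝ, (∀ n j, 0 < a n j) ∧
      ∀ {Ω' : Type*} [MeasurableSpace Ω'] (P' : Measure Ω') [IsProbabilityMeasure P']
        (S : ℕ → Ω' → Fin d → ℝ),
        (∀ m, HasLaw (S m) (ExtSkewNormal.esn R α τ) P') → iIndepFun S P' →
        ∀ x : Fin d → ℝ,
          Tendsto (fun n : ℕ =>
              P'.real {ω | ∀ j, (ExtSkewNormal.sampleMax S n j ω - b n j) / a n j ≤ x j})
            atTop (𝓝 (∏ j, Real.exp (-Real.exp (-x j)))) := by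
  have hμ : IsProbabilityMeasure (ExtSkewNormal.esn R α τ) :=
    hX.isProbabilityMeasure_iff.1 inferInstance
  refine ⟨fun i j hij => ExtSkewNormal.tendsto_tailDependence hR hX hij.ne, ?_⟩
  obtain ⟨b, hb⟩ := ExtSkewNormal.exists_marginal_quantiles R α τ
  set κ : Fin d → ℝ := fun j => ExtSkewNormal.tailRate (ExtSkewNormal.marginalSlant R α j)
  have hκ : ∀ j, 0 < κ j := fun j => ExtSkewNormal.tailRate_pos _
  -- The scale is the von Mises shift 1/(κ t) at the quantile t = b. The value 1 only secures
  -- positivity at the n where b is not yet positive.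
  refine ⟨fun n j => if 0 < b n j then (κ j * b n j)⁻¹ else 1, b, fun n j => ?_, ?_⟩
  · dsimp only
    split_ifs with h
    · exact inv_pos.2 (mul_pos (hκ j) h)
    · exact one_pos
  intro Ω' _ P' _ S hS hind x
  have hlevel : ∀ j, Tendsto (fun n => b n j + x j / (κ j * b n j)) atTop atTop := fun j =>
    (hb j).1.atTop_add
      (tendsto_const_nhds.div_atTop ((hb j).1.const_mul_atTop (hκ j)))
  have htail : ∀ j, Tendsto (fun n : ℕ =>
      n * ExtSkewNormal.marginalTail R α τ j (b n j + x j / (κ j * b n j))) atTop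
      (𝓝 (Real.exp (-x j))) := by
    intro j
    have h := (ExtSkewNormal.tendsto_skewTail_ratio (β := ExtSkewNormal.marginalSlant R α j)
      (γ := τ / Real.sqrt (ExtSkewNormal.residualVar R α j))
      (ExtSkewNormal.esnConst_pos (R := R) α τ) (x j)).comp (hb j).1
    refine h.congr' ?_
    filter_upwards [(hb j).2] with n hn
    have hn' : ExtSkewNormal.skewTail (ExtSkewNormal.esnConst R α τ)
        (ExtSkewNormal.marginalSlant R α j)
        (τ / Real.sqrt (ExtSkewNormal.residualVar R α j)) (b n j) = (n : ℝ)⁻¹ := hn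
    simp only [Function.comp_apply]
    rw [hn', div_inv_eq_mul, mul_comm]
    rfl
  refine (ExtSkewNormal.tendsto_esn_real_orthant_pow hR hlevel htail).congr' ?_
  filter_upwards [eventually_ne_atTop 0,
    eventually_all.2 fun j => (hb j).1.eventually_gt_atTop 0] with n hn hpos
  rw [← ExtSkewNormal.measureReal_sampleMax_le hS hind hn]
  congr 1
  ext ω
  refine forall_congr' fun j => ?_
  have hκb := mul_pos (hκ j) (hpos j)
  rw [if_pos (hpos j), div_le_iff₀ (inv_pos.2 hκb), sub_le_iff_le_add', div_eq_mul_inv]
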